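/- Let $q$ be a power of an odd prime $p$ (with $p=3$ allowed) such that $q\equiv 3 \pmod 4$, and let $a\in\mathbb F_q^*$. Let $\phi$ be the quadratic character of $\mathbb F_q$ (with $\phi(0)=0$), let $\psi(y)=\exp\big(\tfrac{2\pi i}{p}\operatorname{Tr}_{\mathbb F_q/\mathbb F_p}(y)\big)$ and $\psi_2(z)=\exp\big(\tfrac{2\pi i}{p}\operatorname{Tr}_{\mathbb F_{q^2}/\mathbb F_p}(z)\big)$ be the canonical additive characters of $\mathbb F_q$ and $\mathbb F_{q^2}$, and let $G(\phi)=\sum_{y\in\mathbb F_q}\phi(y)\psi(y)$. Let $M_8$ be a multiplicative character of $\mathbb F_{q^2}$ of exact order $8$ with values in $\mathbb C$ (with $M_8(0)=0$), let $N(z)=z^{q+1}$ be the norm from $\mathbb F_{q^2}$ to $\mathbb F_q$, and let $\tau\in\mathbb C$ satisfy $\tau^2=q\,M_8(-a)$. For $j,k\in\mathbb F_q$ put $$P(j,k)=\delta(j,k)+\phi(-1)\,\delta(j,-k)+\frac1{G(\phi)}\sum_{x\in\mathbb F_q^*}\phi\!\left(\frac ax-x\right)\psi\!\left(x(j+k)^2+\frac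 ax(j-k)^2\right),$$ where $\delta$ is the Kronecker delta, and $$V(j)=\tau^{-1}\phi(j)\sum_{\substack{z\in\mathbb F_{q^2}\\ N(z)=a}}M_8(z)\,\psi_2(j^2z).$$ Then $P(j,k)=V(j)V(k)$ for all $j,k\in\mathbb F_q$. -/

import Mathlib

open scoped BigOperators

noncomputable section

namespace KatzSums

/-- The canonical additive character `y ↦ exp (2 π i Tr(y) / p)` of a finite field `F` of
characteristic `p`, where `Tr(y) = y^p + y^(p^2) + ⋯ + y^(#F)` is the trace to the prime field.
It serves as `ψ` on `𝔽_q` and as `ψ₂` on `𝔽_{q²}`. -/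
def psi (p : ℕ) [Fact p.Prime] (F : Type*) [Field F] [Algebra (ZMod p) F] : AddChar F ℂ :=
  (ZMod.stdAddChar (N := p)).compAddMonoidHom (Algebra.trace (ZMod p) F).toAddMonoidHom

/-- The quadratic character of `F`, with complex values and `φ(0) = 0`. -/
def phi (F : Type*) [Field F] [Fintype F] [DecidableEq F] : MulChar F ℂ :=
  (quadraticChar F).ringHomComp (Int.castRingHom ℂ)

/-- The mixed exponential sum
`P(j,k) = δ(j,k) + φ(-1) δ(j,-k)
  + G(φ)⁻¹ ∑_{x ≠ 0} φ(a/x - x) ψ(x (j+k)² + (a/x) (j-k)²)`. -/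
def P (p : ℕ) [Fact p.Prime] {F : Type*} [Field F] [Fintype F] [DecidableEq F]
    [Algebra (ZMod p) F] (a j k : F) : ℂ :=
  (if j = k then 1 else 0) + phi F (-1) * (if j = -k then 1 else 0) +
    1 / gaussSum (phi F) (psi p F) *
      ∑ x : F with x ≠ 0,
        phi F (a / x - x) * psi p F (x * (j + k) ^ 2 + (a / x) * (j - k) ^ 2)

/-- The norm-restricted Gauss sum
`V(j) = τ⁻¹ φ(j) ∑_{z ∈ K, N z = a} M₈(z) ψ₂(j² z)`, where `N` is the norm from `K` to `F`. -/
def V (p : ℕ) [Fact p.Prime] {F K : Type*} [Field F] [Fintype F] [DecidableEq F]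
    [Field K] [Fintype K] [Algebra F K] [Algebra (ZMod p) K]
    (M₈ : MulChar K ℂ) (τ : ℂ) (a j : F) : ℂ :=
  τ⁻¹ * phi F j *
    ∑ z : K with Algebra.norm F z = a, M₈ z * psi p K (algebraMap F K j ^ 2 * z)

end KatzSums

end

/-!
The fibre `{z | N z = n}` of the norm and the hyperbola `{(x, n / x)}` are the nonsplit and the
split form of the same conic: between them, the trace `z ↦ Tr z` and the map `x ↦ x + n / x` take
each value `y` exactly twice, once for each root of `X² - y X + n`. Hence additive character sums
over a norm fibre are negatives of Kloosterman sums, up to a degenerate term.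

Substituting `w = s * conj z` with `N s = 1` in the product of the sums over `N z = a` and `N w = a`
therefore turns `V(j) V(k)` into `∑_{N s = 1} M₈(s) Kl(a ((j² - k²)² + j² k² (Tr s + 2)))`; the
Kronecker deltas come from the degenerate term at `s = -1`, where the argument of the additive
character vanishes if `j² = k²`.

In that sum the `s` with `M₈(s) = ± i` cancel in conjugate pairs, and the others are the squares
`s = r²` of elements of norm one; there `M₈(s) = M₈(r)²` is `φ(Tr r + 2)`, unless `Tr r = -2`, and
`Tr s + 2 = (Tr r)²`. This is where order `8` and `q ≡ 3 mod 4` enter, and it leaves a sum of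
`φ(t + 2jk) Kl(a ((j² - k²)² + t²))` over `t ∈ 𝔽_q`. Expanding `φ(a / x - x)` in `P` by means of the
Gauss sum also gives a correlation of `φ` with Kloosterman sums, and evaluating quadratic Gauss
sums in one variable identifies the two.
-/

namespace KatzSums

section QuadraticCharacter

variable {F : Type*} [Field F] [Fintype F]

theorem ringChar_ne_two (hq : Fintype.card F % 4 = 3) : ringChar F ≠ 2 := fun h => by
  have := FiniteField.even_card_of_char_two h
  omega

variable [DecidableEq F]

theorem phi_apply (x : F) : phi F x = (quadraticChar F x : ℂ) := rfl

theorem phi_isQuadratic : (phi F).IsQuadratic := (quadraticChar_isQuadratic F).comp _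

theorem phi_sq_eq_one {x : F} (hx : x ≠ 0) : phi F (x ^ 2) = 1 := by
  rw [phi_apply, quadraticChar_sq_one' hx, Int.cast_one]

theorem phi_mul_self {x : F} (hx : x ≠ 0) : phi F x * phi F x = 1 := by
  rw [← map_mul, ← sq, phi_sq_eq_one hx]

theorem phi_eq_neg_one_iff_not_isSquare {x : F} : phi F x = -1 ↔ ¬IsSquare x := by
  rw [← quadraticChar_neg_one_iff_not_isSquare, phi_apply]
  norm_cast

theorem phi_neg_one (hq : Fintype.card F % 4 = 3) : phi F (-1) = -1 := by
  rw [phi_eq_neg_one_iff_not_isSquare, FiniteField.isSquare_neg_one_iff]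
  exact not_not_intro hq

theorem phi_neg (hq : Fintype.card F % 4 = 3) (x : F) : phi F (-x) = -phi F x := by
  rw [← neg_one_mul, map_mul, phi_neg_one hq, neg_one_mul]

theorem phi_ne_one (hF : ringChar F ≠ 2) : phi F ≠ 1 :=
  (MulChar.ringHomComp_ne_one_iff Int.cast_injective).2 (quadraticChar_ne_one hF)

theorem eq_phi_of_orderOf_eq_two {χ : MulChar F ℂ} (hχ : orderOf χ = 2) : χ = phi F := by
  have hχ2 : χ ^ 2 = 1 := hχ ▸ pow_orderOf_eq_one χ
  have hsquare {x : F} (hx : x ≠ 0) (h : IsSquare x) : χ x = 1 := by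
    obtain ⟨r, rfl⟩ := h
    rw [map_mul, ← sq, ← MulChar.pow_apply' _ two_ne_zero, hχ2,
      MulChar.one_apply (isUnit_iff_ne_zero.2 (left_ne_zero_of_mul hx))]
  obtain ⟨u, hu⟩ : ∃ u : Fˣ, χ u ≠ 1 :=
    MulChar.ne_one_iff.1 fun h => by simp [h] at hχ
  have hu' : phi F u = -1 :=
    phi_eq_neg_one_iff_not_isSquare.2 fun h => hu (hsquare u.ne_zero h)
  have hχu : χ u = -1 := by
    refine (sq_eq_one_iff.1 ?_).resolve_left hu
    rw [← MulChar.pow_apply_coe, hχ2, MulChar.one_apply_coe]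
  ext x
  by_cases hx : IsSquare (x : F)
  · obtain ⟨r, hr⟩ := id hx
    rw [hsquare x.ne_zero hx, hr, ← sq, phi_sq_eq_one fun h => x.ne_zero (by simp [hr, h])]
  · have hφx : phi F x = -1 := phi_eq_neg_one_iff_not_isSquare.2 hx
    have hux : IsSquare (u * x : F) := by
      by_contra h
      have := phi_eq_neg_one_iff_not_isSquare.2 h
      rw [map_mul, hu', hφx] at this
      norm_num at this
    have := hsquare (mul_ne_zero u.ne_zero x.ne_zero) hux
    rw [map_mul, hχu] at this
    rw [hφx]
    linear_combination -this

theorem sum_phi_mul_addChar_mul (hF : ringChar F ≠ 2) (ψ : AddChar F ℂ) (y : F) :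
    ∑ l, phi F l * ψ (y * l) = phi F y * gaussSum (phi F) ψ := by
  rcases eq_or_ne y 0 with rfl | hy
  · simp [MulChar.sum_eq_zero_of_ne_one (phi_ne_one hF), MulChar.map_zero]
  · rw [← gaussSum_mulShift (phi F) ψ (Units.mk0 y hy), Units.val_mk0, ← mul_assoc, phi_mul_self hy,
      one_mul]
    rfl

theorem gaussSum_phi_sq (hq : Fintype.card F % 4 = 3) {ψ : AddChar F ℂ} (hψ : ψ.IsPrimitive) :
    gaussSum (phi F) ψ ^ 2 = -(Fintype.card F : ℂ) := by
  rw [gaussSum_sq (phi_ne_one (ringChar_ne_two hq)) phi_isQuadratic hψ, phi_neg_one hq, neg_one_mul]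

theorem gaussSum_phi_ne_zero (hF : ringChar F ≠ 2) {ψ : AddChar F ℂ} (hψ : ψ.IsPrimitive) :
    gaussSum (phi F) ψ ≠ 0 :=
  gaussSum_ne_zero_of_nontrivial (Nat.cast_ne_zero.2 Fintype.card_ne_zero) (phi_ne_one hF) hψ

end QuadraticCharacter

section Sums

variable {F A : Type*} [Field F] [Fintype F] [AddCommMonoid A]

theorem sum_comp_mul_left {c : F} (hc : c ≠ 0) (f : F → A) : ∑ x, f (c * x) = ∑ x, f x :=
  Equiv.sum_comp (Equiv.mulLeft₀ c hc) f

variable [DecidableEq F]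

theorem sum_ne_zero_comp_mul_left {c : F} (hc : c ≠ 0) (f : F → A) :
    ∑ x with x ≠ 0, f (c * x) = ∑ x with x ≠ 0, f x :=
  Finset.sum_equiv (Equiv.mulLeft₀ c hc) (by simp [hc]) (by simp)

theorem sum_ne_zero_comp_div {a : F} (ha : a ≠ 0) (f : F → A) :
    ∑ x with x ≠ 0, f (a / x) = ∑ x with x ≠ 0, f x :=
  Finset.sum_nbij' (a / ·) (a / ·) (by simp [ha]) (by simp [ha])
    (fun _ _ => div_div_cancel₀ ha) (fun _ _ => div_div_cancel₀ ha) (by simp)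

theorem sum_ite_sq_eq (hF : ringChar F ≠ 2) (d : F) :
    ∑ e : F, (if e ^ 2 = d then (1 : ℂ) else 0) = 1 + phi F d := by
  have h := quadraticChar_card_sqrts hF d
  rw [Finset.sum_boole, phi_apply, add_comm]
  rw [Set.toFinset_ofPred] at h
  exact_mod_cast h

theorem sum_comp_sq (hF : ringChar F ≠ 2) (f : F → ℂ) :
    ∑ t, f (t ^ 2) = ∑ y, (1 + phi F y) * f y := by
  simp_rw [← sum_ite_sq_eq hF, Finset.sum_mul]
  rw [Finset.sum_comm]
  simp

theorem sum_ite_quadratic_eq_zero (hF : ringChar F ≠ 2) (y n : F) :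
    ∑ x : F, (if x ^ 2 - y * x + n = 0 then (1 : ℂ) else 0) = 1 + phi F (y ^ 2 - 4 * n) := by
  have h2 : (2 : F) ≠ 0 := Ring.two_ne_zero hF
  rw [← sum_ite_sq_eq hF]
  refine Fintype.sum_equiv ((Equiv.mulLeft₀ 2 h2).trans (Equiv.subRight y)) _ _ fun x => ?_
  refine if_congr ?_ rfl rfl
  have h4 : (4 : F) ≠ 0 := by
    rw [show (4 : F) = 2 ^ 2 by norm_num]
    exact pow_ne_zero 2 h2
  simp only [Equiv.trans_apply, Equiv.mulLeft₀_apply, Equiv.subRight_apply]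
  constructor <;> intro h
  · linear_combination 4 * h
  · exact mul_left_cancel₀ h4 (by linear_combination h)

theorem sum_comp_add_div (hF : ringChar F ≠ 2) {n : F} (hn : n ≠ 0) (f : F → ℂ) :
    ∑ x : F with x ≠ 0, f (x + n / x) = ∑ y, (1 + phi F (y ^ 2 - 4 * n)) * f y := by
  simp_rw [← sum_ite_quadratic_eq_zero hF, Finset.sum_mul]
  rw [Finset.sum_comm, Finset.sum_filter]
  refine Finset.sum_congr rfl fun x _ => ?_
  rcases eq_or_ne x 0 with rfl | hx
  · simp [hn]
  · have (y : F) : x ^ 2 - y * x + n = 0 ↔ x + n / x = y := by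
      rw [← mul_left_inj' (a := x + n / x) (b := y) hx, add_mul, div_mul_cancel₀ _ hx]
      constructor <;> intro h <;> linear_combination h
    simp [this, hx]

end Sums

section Kloosterman

variable {F : Type*} [Field F] [Fintype F] [DecidableEq F] {ψ : AddChar F ℂ}

/-- The Kloosterman sum `∑_{x ≠ 0} ψ(x + n/x)`, including the degenerate case `n = 0`. -/
noncomputable def kloostermanSum (ψ : AddChar F ℂ) (n : F) : ℂ := ∑ x : F with x ≠ 0, ψ (x + n / x)

theorem sum_mul_add_div (ψ : AddChar F ℂ) {c d : F} (h : c ≠ 0 ∨ d ≠ 0) :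
    ∑ x with x ≠ 0, ψ (c * x + d / x) = kloostermanSum ψ (c * d) := by
  rcases eq_or_ne c 0 with rfl | hc
  · simpa [kloostermanSum] using sum_ne_zero_comp_div (h.resolve_left (not_not_intro rfl)) ψ
  · rw [kloostermanSum, ← sum_ne_zero_comp_mul_left hc fun y => ψ (y + c * d / y)]
    simp only [mul_div_mul_left _ _ hc]

theorem kloostermanSum_zero (hψ : ψ ≠ 1) : kloostermanSum ψ 0 = -1 := by
  have h := AddChar.sum_eq_zero_of_ne_one hψ
  rw [← Finset.add_sum_erase _ _ (Finset.mem_univ 0), AddChar.map_zero_eq_one] at h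
  simp only [kloostermanSum, zero_div, add_zero, Finset.filter_ne']
  linear_combination h

theorem sum_addChar_quadratic (hF : ringChar F ≠ 2) (hψ : ψ.IsPrimitive) {c : F} (hc : c ≠ 0)
    (l : F) :
    ∑ t, ψ (c * t ^ 2 + l * t) = phi F c * gaussSum (phi F) ψ * ψ (-(l ^ 2 / (4 * c))) := by
  have h2 : (2 : F) ≠ 0 := Ring.two_ne_zero hF
  have hsq (t : F) : c * t ^ 2 + l * t = c * (t + l / (2 * c)) ^ 2 + -(l ^ 2 / (4 * c)) := by
    rw [show (4 : F) = 2 * 2 by norm_num]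
    field_simp
    ring
  have hlin : ∑ t, ψ (c * t) = 0 := by
    simpa [mul_comm, hc] using AddChar.sum_mulShift c hψ
  calc ∑ t, ψ (c * t ^ 2 + l * t)
    _ = (∑ t, ψ (c * t ^ 2)) * ψ (-(l ^ 2 / (4 * c))) := by
      simp_rw [hsq, AddChar.map_add_eq_mul, ← Finset.sum_mul]
      congr 1
      exact Equiv.sum_comp (Equiv.addRight (l / (2 * c))) fun t => ψ (c * t ^ 2)
    _ = (∑ t, phi F t * ψ (c * t)) * ψ (-(l ^ 2 / (4 * c))) := by
      rw [sum_comp_sq hF fun y => ψ (c * y)]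
      simp only [add_mul, one_mul, Finset.sum_add_distrib, hlin, zero_add]
    _ = _ := by rw [sum_phi_mul_addChar_mul hF]

theorem sum_phi_add_mul_addChar_sq (hF : ringChar F ≠ 2) (hψ : ψ.IsPrimitive) {c : F}
    (hc : c ≠ 0) (e : F) :
    ∑ t, phi F (t + e) * ψ (c * t ^ 2) =
      phi F 2 * ∑ m, phi F m * ψ (c * (2 * e * m - m ^ 2)) := by
  have h2 : (2 : F) ≠ 0 := Ring.two_ne_zero hF
  refine mul_left_cancel₀ (gaussSum_phi_ne_zero hF hψ) ?_
  calc gaussSum (phi F) ψ * ∑ t, phi F (t + e) * ψ (c * t ^ 2)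
    _ = ∑ t, ∑ l, phi F l * ψ (e * l) * ψ (c * t ^ 2 + l * t) := by
      rw [Finset.mul_sum]
      refine Finset.sum_congr rfl fun t _ => ?_
      rw [← mul_assoc, mul_comm (gaussSum _ _), ← sum_phi_mul_addChar_mul hF, Finset.sum_mul]
      refine Finset.sum_congr rfl fun l _ => ?_
      rw [mul_assoc, mul_assoc, ← AddChar.map_add_eq_mul, ← AddChar.map_add_eq_mul]
      congr 2
      ring
    _ = phi F c * gaussSum (phi F) ψ * ∑ l, phi F l * ψ (e * l - l ^ 2 / (4 * c)) := by
      rw [Finset.sum_comm, Finset.mul_sum]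
      refine Finset.sum_congr rfl fun l _ => ?_
      rw [← Finset.mul_sum, sum_addChar_quadratic hF hψ hc, sub_eq_add_neg (e * l),
        AddChar.map_add_eq_mul]
      ring
    _ = phi F c * gaussSum (phi F) ψ *
          ∑ m, phi F (2 * c) * (phi F m * ψ (c * (2 * e * m - m ^ 2))) := by
      rw [← sum_comp_mul_left (mul_ne_zero h2 hc)]
      congr! 2 with m
      rw [map_mul, mul_assoc]
      congr! 3
      rw [show (4 : F) = 2 * 2 by norm_num]
      field_simp
    _ = _ := by
      rw [← Finset.mul_sum, map_mul]
      linear_combination (phi F 2 * gaussSum (phi F) ψ *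
        ∑ m, phi F m * ψ (c * (2 * e * m - m ^ 2))) * phi_mul_self hc

theorem sum_phi_add_mul_kloostermanSum (hF : ringChar F ≠ 2) (hψ : ψ.IsPrimitive) {a : F}
    (ha : a ≠ 0) (n e : F) :
    ∑ t, phi F (t + e) * kloostermanSum ψ (a * (n + t ^ 2)) =
      phi F 2 * ∑ m, phi F m * kloostermanSum ψ (a * (n + (2 * e * m - m ^ 2))) := by
  have hsplit (g w : F → F) :
      ∑ t, phi F (g t) * kloostermanSum ψ (a * (n + w t)) =
        ∑ x with x ≠ 0, ψ (x + a * n / x) * ∑ t, phi F (g t) * ψ (a / x * w t) := by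
    simp_rw [kloostermanSum, Finset.mul_sum]
    rw [Finset.sum_comm]
    refine Finset.sum_congr rfl fun x _ => Finset.sum_congr rfl fun t _ => ?_
    rw [show x + a * (n + w t) / x = (x + a * n / x) + a / x * w t by ring,
      AddChar.map_add_eq_mul]
    ring
  rw [hsplit (· + e) (· ^ 2), hsplit (fun m => m) fun m => 2 * e * m - m ^ 2, Finset.mul_sum]
  refine Finset.sum_congr rfl fun x hx => ?_
  rw [sum_phi_add_mul_addChar_sq hF hψ (div_ne_zero ha (Finset.mem_filter.1 hx).2), mul_left_comm]

/-- The mixed sum `∑_{x ≠ 0} φ(a/x - x) ψ(A x + B a/x)`: up to its delta terms and its Gauss sum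
factor, `P p a j k` is the case `A = (j + k)²`, `B = (j - k)²`. -/
noncomputable def mixedSum (ψ : AddChar F ℂ) (a A B : F) : ℂ :=
  ∑ x : F with x ≠ 0, phi F (a / x - x) * ψ (x * A + a / x * B)

theorem mixedSum_self_eq_zero (hq : Fintype.card F % 4 = 3) (ψ : AddChar F ℂ) {a : F}
    (ha : a ≠ 0) (A : F) : mixedSum ψ a A A = 0 := by
  have h : mixedSum ψ a A A = -mixedSum ψ a A A := by
    conv_lhs => rw [mixedSum, ← sum_ne_zero_comp_div ha]
    rw [mixedSum, ← Finset.sum_neg_distrib]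
    refine Finset.sum_congr rfl fun x _ => ?_
    rw [div_div_cancel₀ ha, ← neg_sub, phi_neg hq, neg_mul, add_comm]
  exact self_eq_neg.1 h

theorem gaussSum_mul_mixedSum (hF : ringChar F ≠ 2) (ψ : AddChar F ℂ) {a A B : F} (ha : a ≠ 0)
    (hAB : A + B ≠ 0) :
    gaussSum (phi F) ψ * mixedSum ψ a A B =
      ∑ m, phi F m * kloostermanSum ψ (a * ((A - m) * (B + m))) := by
  have hne (m : F) : A - m ≠ 0 ∨ a * (B + m) ≠ 0 := by
    by_contra! h
    exact hAB (by linear_combination h.1 + (mul_eq_zero.1 h.2).resolve_left ha)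
  simp_rw [mul_left_comm a, ← sum_mul_add_div ψ (hne _), mixedSum, Finset.mul_sum]
  rw [Finset.sum_comm]
  refine Finset.sum_congr rfl fun x _ => ?_
  rw [← mul_assoc, mul_comm (gaussSum _ _), ← sum_phi_mul_addChar_mul hF, Finset.sum_mul]
  refine Finset.sum_congr rfl fun m _ => ?_
  rw [mul_assoc, ← AddChar.map_add_eq_mul]
  congr 2
  ring

end Kloosterman

section QuadraticExtension

variable {F K : Type*} [Field F] [Field K] [Algebra F K]

theorem trace_algebraMap_mul (x : F) (z : K) :
    Algebra.trace F K (algebraMap F K x * z) = x * Algebra.trace F K z := by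
  rw [← Algebra.smul_def, map_smul, smul_eq_mul]

theorem sum_norm_eq_comp_mul_right {A : Type*} [AddCommMonoid A] [DecidableEq F] [Fintype K]
    (n : F) {c : K} (hc : c ≠ 0) (f : K → A) :
    ∑ z : K with Algebra.norm F z = n, f (z * c) =
      ∑ z : K with Algebra.norm F z = n * Algebra.norm F c, f z :=
  Finset.sum_equiv (Equiv.mulRight₀ c hc)
    (by simp [Algebra.norm_ne_zero_iff.2 hc]) (by simp)

variable [Algebra.IsQuadraticExtension F K]

section Conjugation

variable [Fintype F]

variable (F K) in
/-- The nontrivial automorphism of a quadratic extension of finite fields, realised as the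
Frobenius map `z ↦ z ^ #F`. -/
noncomputable def conj : K ≃ₐ[F] K := FiniteField.frobeniusAlgEquivOfAlgebraic F K

theorem conj_apply (z : K) : conj F K z = z ^ Fintype.card F := rfl

theorem norm_conj (z : K) : Algebra.norm F (conj F K z) = Algebra.norm F z :=
  Algebra.norm_eq_of_algEquiv _ z

theorem trace_conj (z : K) : Algebra.trace F K (conj F K z) = Algebra.trace F K z :=
  Algebra.trace_eq_of_algEquiv _ z

theorem algebraMap_trace (z : K) :
    algebraMap F K (Algebra.trace F K z) = z + conj F K z := by
  have := Module.finite_of_finite F (M := K)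
  rw [FiniteField.algebraMap_trace_eq_sum_pow, Algebra.IsQuadraticExtension.finrank_eq_two,
    Finset.sum_range_succ, Finset.sum_range_one, conj_apply, pow_zero, pow_one, pow_one,
    Nat.card_eq_fintype_card]

theorem algebraMap_norm (z : K) : algebraMap F K (Algebra.norm F z) = z * conj F K z := by
  have := Module.finite_of_finite F (M := K)
  rw [FiniteField.algebraMap_norm_eq_prod_pow, Algebra.IsQuadraticExtension.finrank_eq_two,
    Finset.prod_range_succ, Finset.prod_range_one, conj_apply, pow_zero, pow_one, pow_one,
    Nat.card_eq_fintype_card]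

theorem conj_conj (z : K) : conj F K (conj F K z) = z := by
  have h := congrArg (algebraMap F K) (trace_conj z)
  rw [algebraMap_trace, algebraMap_trace, add_comm z] at h
  exact add_left_cancel h

theorem exists_conj_ne_self : ∃ z : K, conj F K z ≠ z := by
  by_contra! h
  have := Module.finite_of_finite F (M := K)
  have horder := FiniteField.orderOf_frobeniusAlgEquivOfAlgebraic F K
  rw [show FiniteField.frobeniusAlgEquivOfAlgebraic F K = 1 from AlgEquiv.ext h, orderOf_one,
    Algebra.IsQuadraticExtension.finrank_eq_two] at horder
  exact absurd horder (by norm_num)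

end Conjugation

theorem norm_algebraMap_add [Finite F] (x : F) (z : K) :
    Algebra.norm F (algebraMap F K x + z) =
      x ^ 2 + x * Algebra.trace F K z + Algebra.norm F z := by
  have := Fintype.ofFinite F
  apply (algebraMap F K).injective
  simp only [map_add, map_mul, map_pow, algebraMap_norm, algebraMap_trace, AlgEquiv.commutes]
  ring

theorem trace_algebraMap_add (x : F) (z : K) :
    Algebra.trace F K (algebraMap F K x + z) = 2 * x + Algebra.trace F K z := by
  rw [map_add, Algebra.trace_algebraMap, Algebra.IsQuadraticExtension.finrank_eq_two, two_nsmul,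
    two_mul]

theorem norm_algebraMap_mul (x : F) (z : K) :
    Algebra.norm F (algebraMap F K x * z) = x ^ 2 * Algebra.norm F z := by
  rw [map_mul, Algebra.norm_algebraMap, Algebra.IsQuadraticExtension.finrank_eq_two]

theorem trace_sq [Finite F] (z : K) :
    Algebra.trace F K (z ^ 2) = Algebra.trace F K z ^ 2 - 2 * Algebra.norm F z := by
  have := Fintype.ofFinite F
  apply (algebraMap F K).injective
  simp only [map_sub, map_mul, map_pow, algebraMap_norm, algebraMap_trace, map_ofNat]
  ring

theorem one_add_sq_of_norm_eq_one [Finite F] {s : K} (hs : Algebra.norm F s = 1) :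
    (1 + s) ^ 2 = s * algebraMap F K (Algebra.trace F K s + 2) := by
  have := Fintype.ofFinite F
  have h := algebraMap_norm (F := F) s
  rw [hs, map_one] at h
  rw [map_add, algebraMap_trace, map_ofNat]
  linear_combination h

theorem exists_trace_eq_zero_and_phi_neg_norm [Fintype F] [DecidableEq F] (hF : ringChar F ≠ 2) :
    ∃ δ : K, Algebra.trace F K δ = 0 ∧ phi F (-Algebra.norm F δ) = -1 := by
  obtain ⟨z, hz⟩ := exists_conj_ne_self (F := F) (K := K)
  have hconj : conj F K (z - conj F K z) = -(z - conj F K z) := by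
    rw [map_sub, conj_conj, neg_sub]
  refine ⟨z - conj F K z, by rw [map_sub, trace_conj, sub_self], ?_⟩
  rw [phi_eq_neg_one_iff_not_isSquare]
  rintro ⟨s, hs⟩
  have hsq : (z - conj F K z) * (z - conj F K z) = algebraMap F K s * algebraMap F K s := by
    rw [← map_mul, ← hs, map_neg, algebraMap_norm, hconj, mul_neg, neg_neg]
  have hfixed : conj F K (z - conj F K z) = z - conj F K z := by
    rcases mul_self_eq_mul_self_iff.1 hsq with h | h <;> rw [h] <;>
      simp only [map_neg, AlgEquiv.commutes]
  have hK : ringChar K ≠ 2 := Algebra.ringChar_eq F K ▸ hF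
  rw [hconj, Ring.eq_self_iff_eq_zero_of_char_ne_two hK] at hfixed
  exact hz (sub_eq_zero.1 hfixed).symm

theorem bijective_algebraMap_add_mul [Finite F] (hF : ringChar F ≠ 2) {δ : K} (hδ : δ ≠ 0)
    (htr : Algebra.trace F K δ = 0) :
    Function.Bijective fun w : F × F => algebraMap F K w.1 + algebraMap F K w.2 * δ := by
  have := Module.finite_of_finite F (M := K)
  have := Fintype.ofFinite F
  have := Fintype.ofFinite K
  refine (Fintype.bijective_iff_injective_and_card _).2 ⟨fun w w' h => ?_, ?_⟩
  · have htrace := congrArg (Algebra.trace F K) h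
    simp only [trace_algebraMap_add, trace_algebraMap_mul, htr, mul_zero, add_zero] at htrace
    have h1 : w.1 = w'.1 := mul_left_cancel₀ (Ring.two_ne_zero hF) htrace
    simp only [h1, add_right_inj] at h
    exact Prod.ext h1 ((algebraMap F K).injective (mul_right_cancel₀ hδ h))
  · rw [Fintype.card_prod, Module.card_eq_pow_finrank (K := F) (V := K),
      Algebra.IsQuadraticExtension.finrank_eq_two, sq]

theorem phi_eq_phi_norm [Fintype F] [DecidableEq F] [Fintype K] [DecidableEq K]
    (hF : ringChar F ≠ 2) (z : K) : phi K z = phi F (Algebra.norm F z) := by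
  have hK : ringChar K ≠ 2 := Algebra.ringChar_eq F K ▸ hF
  have hexp : Fintype.card K / 2 = (1 + Fintype.card F) * (Fintype.card F / 2) := by
    obtain ⟨m, hm⟩ := Nat.odd_iff.2 (FiniteField.odd_card_of_char_ne_two hF)
    rw [Module.card_eq_pow_finrank (K := F) (V := K), Algebra.IsQuadraticExtension.finrank_eq_two,
      hm, show (2 * m + 1) ^ 2 = 2 * ((1 + (2 * m + 1)) * m) + 1 by ring,
      show (2 * m + 1) / 2 = m by omega]
    omega
  have h : ((quadraticChar K z : ℤ) : K) = (quadraticChar F (Algebra.norm F z) : ℤ) := by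
    rw [quadraticChar_eq_pow_of_char_ne_two' hK, ← map_intCast (algebraMap F K),
      quadraticChar_eq_pow_of_char_ne_two' hF, map_pow, algebraMap_norm, conj_apply, hexp,
      pow_mul, pow_add, pow_one]
  rw [phi_apply, phi_apply, (quadraticChar_isQuadratic K).eq_of_eq_coe
    (quadraticChar_isQuadratic F) hK h]

section NormSums

variable [Fintype F] [DecidableEq F] [Fintype K]

theorem sum_norm_eq_comp_trace (hF : ringChar F ≠ 2) (n : F) (f : F → ℂ) :
    ∑ z : K with Algebra.norm F z = n, f (Algebra.trace F K z) =
      ∑ y, (1 - phi F (y ^ 2 - 4 * n)) * f y := by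
  obtain ⟨δ, htr, hφδ⟩ := exists_trace_eq_zero_and_phi_neg_norm (K := K) hF
  have hN : Algebra.norm F δ ≠ 0 := by
    intro h
    simp [h, MulChar.map_zero] at hφδ
  have hcount (x : F) :
      ∑ y : F, (if x ^ 2 + y ^ 2 * Algebra.norm F δ = n then (1 : ℂ) else 0) =
        1 - phi F ((2 * x) ^ 2 - 4 * n) := by
    have hdisc :
        (2 * x) ^ 2 - 4 * n = (n - x ^ 2) / Algebra.norm F δ * -Algebra.norm F δ * 2 ^ 2 := by
      field_simp
      ring
    rw [hdisc, map_mul, map_mul, hφδ, phi_sq_eq_one (Ring.two_ne_zero hF), mul_one, mul_neg_one,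
      sub_neg_eq_add, ← sum_ite_sq_eq hF]
    refine Finset.sum_congr rfl fun y _ => if_congr ?_ rfl rfl
    rw [eq_div_iff hN, eq_sub_iff_add_eq']
  rw [Finset.sum_filter, ← sum_comp_mul_left (Ring.two_ne_zero hF),
    ← (bijective_algebraMap_add_mul hF (Algebra.norm_ne_zero_iff.1 hN) htr).sum_comp,
    Fintype.sum_prod_type]
  refine Finset.sum_congr rfl fun x _ => ?_
  simp only [norm_algebraMap_add, trace_algebraMap_add, norm_algebraMap_mul, trace_algebraMap_mul,
    htr, mul_zero, add_zero, ← hcount, Finset.sum_mul, ite_mul, one_mul, zero_mul]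

theorem sum_norm_eq_comp_trace_add_sum_comp_add_div (hF : ringChar F ≠ 2) {n : F} (hn : n ≠ 0)
    (f : F → ℂ) :
    ∑ z : K with Algebra.norm F z = n, f (Algebra.trace F K z) +
      ∑ x : F with x ≠ 0, f (x + n / x) = 2 * ∑ y, f y := by
  rw [sum_norm_eq_comp_trace hF, sum_comp_add_div hF hn, ← Finset.sum_add_distrib, Finset.mul_sum]
  exact Finset.sum_congr rfl fun y _ => by ring

theorem sum_norm_eq_addChar_trace_mul (hF : ringChar F ≠ 2) {ψ : AddChar F ℂ} (hψ : ψ ≠ 1)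
    {n : F} (hn : n ≠ 0) (c : K) [Decidable (c = 0)] :
    ∑ z : K with Algebra.norm F z = n, ψ (Algebra.trace F K (z * c)) =
      (if c = 0 then (Fintype.card F : ℂ) else 0) -
        kloostermanSum ψ (n * Algebra.norm F c) := by
  split_ifs with hc
  · have h := sum_norm_eq_comp_trace_add_sum_comp_add_div (K := K) hF hn fun _ => 1
    have hcard : ((Finset.univ.erase (0 : F)).card : ℂ) = Fintype.card F - 1 := by
      rw [Finset.card_erase_of_mem (Finset.mem_univ _), Finset.card_univ,
        Nat.cast_pred Fintype.card_pos]
    simp only [Finset.sum_const, Finset.filter_ne', nsmul_eq_mul, hcard, Finset.card_univ] at h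
    simp only [hc, mul_zero, map_zero, AddChar.map_zero_eq_one, Algebra.norm_zero,
      kloostermanSum_zero hψ, Finset.sum_const, nsmul_eq_mul]
    linear_combination h
  · have h := sum_norm_eq_comp_trace_add_sum_comp_add_div (K := K) hF
      (mul_ne_zero hn (Algebra.norm_ne_zero_iff.2 hc)) ψ
    rw [AddChar.sum_eq_zero_of_ne_one hψ] at h
    rw [sum_norm_eq_comp_mul_right n hc fun z => ψ (Algebra.trace F K z), kloostermanSum]
    linear_combination h

end NormSums

end QuadraticExtension

section OrderEight

variable {F K : Type*} [Field F] [Fintype F] [Field K] [Algebra F K]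
  [Algebra.IsQuadraticExtension F K] [DecidableEq F] {M : MulChar K ℂ}

theorem apply_pow_four_eq_phi_norm (hF : ringChar F ≠ 2) (hM : orderOf M = 8) (z : K) :
    M z ^ 4 = phi F (Algebra.norm F z) := by
  classical
  have := Module.finite_of_finite F (M := K)
  have := Fintype.ofFinite K
  have horder : orderOf (M ^ 4) = 2 := by
    rw [orderOf_pow, hM]
    norm_num
  rw [← phi_eq_phi_norm hF, ← eq_phi_of_orderOf_eq_two horder, MulChar.pow_apply' _ four_ne_zero]

omit [DecidableEq F] in
theorem apply_algebraMap_sq_eq_one (hq : Fintype.card F % 4 = 3) (hM : orderOf M = 8) {w : F}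
    (hw : w ≠ 0) : M (algebraMap F K w) ^ 2 = 1 := by
  classical
  obtain ⟨u, hu⟩ : ∃ u : F, w ^ 2 = u ^ 4 := by
    obtain ⟨u, hu⟩ | ⟨u, hu⟩ : IsSquare w ∨ IsSquare (-w) := by
      by_contra! h
      simp only [← phi_eq_neg_one_iff_not_isSquare, phi_neg hq] at h
      norm_num [h.1] at h
    · exact ⟨u, by rw [hu]; ring⟩
    · exact ⟨u, by rw [← neg_sq, hu]; ring⟩
  have hu0 : u ≠ 0 := by
    rintro rfl
    simp [hw] at hu
  rw [← map_pow, ← map_pow, hu, map_pow, map_pow,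
    apply_pow_four_eq_phi_norm (ringChar_ne_two hq) hM,
    Algebra.norm_algebraMap, Algebra.IsQuadraticExtension.finrank_eq_two, phi_sq_eq_one hu0]

theorem apply_sq_eq_phi_trace_add_two (hq : Fintype.card F % 4 = 3) (hM : orderOf M = 8) {s : K}
    (hs : Algebra.norm F s = 1) (htr : Algebra.trace F K s + 2 ≠ 0) :
    M s ^ 2 = phi F (Algebra.trace F K s + 2) := by
  have hnorm : Algebra.norm F (1 + s) = Algebra.trace F K s + 2 := by
    have := norm_algebraMap_add (F := F) 1 s
    rw [map_one, hs] at this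
    linear_combination this
  calc M s ^ 2
    _ = M (s * algebraMap F K (Algebra.trace F K s + 2)) ^ 2 := by
      rw [map_mul, mul_pow, apply_algebraMap_sq_eq_one hq hM htr, mul_one]
    _ = M (1 + s) ^ 4 := by
      rw [← one_add_sq_of_norm_eq_one hs, map_pow, ← pow_mul]
    _ = _ := by rw [apply_pow_four_eq_phi_norm (ringChar_ne_two hq) hM, hnorm]

theorem apply_neg_one_eq_phi_two (hq : Fintype.card F % 4 = 3) (hM : orderOf M = 8) :
    M (-1) = phi F 2 := by
  have := Module.finite_of_finite F (M := K)
  have := Fintype.ofFinite K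
  have hcard : Fintype.card K % 4 ≠ 3 := by
    rw [Module.card_eq_pow_finrank (K := F) (V := K), Algebra.IsQuadraticExtension.finrank_eq_two,
      Nat.pow_mod, hq]
    norm_num
  obtain ⟨i, hi⟩ := FiniteField.isSquare_neg_one_iff.2 hcard
  have hconj : conj F K i = -i := by
    have hi4 : i ^ 4 = 1 := by linear_combination (1 - i * i) * hi
    rw [conj_apply, ← Nat.div_add_mod (Fintype.card F) 4, hq, pow_add, pow_mul, hi4, one_pow]
    linear_combination -i * hi
  have hnorm : Algebra.norm F i = 1 := by
    apply (algebraMap F K).injective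
    rw [algebraMap_norm, hconj, map_one, mul_neg, ← hi, neg_neg]
  have htrace : Algebra.trace F K i = 0 := by
    apply (algebraMap F K).injective
    rw [algebraMap_trace, hconj, map_zero, add_neg_cancel]
  rw [hi, map_mul, ← sq, apply_sq_eq_phi_trace_add_two hq hM hnorm
    (by rw [htrace, zero_add]; exact Ring.two_ne_zero (ringChar_ne_two hq)), htrace, zero_add]

variable [Fintype K]

theorem sum_norm_eq_one_apply_sq_mul (hq : Fintype.card F % 4 = 3) (hM : orderOf M = 8)
    (f : F → ℂ) :
    ∑ r : K with Algebra.norm F r = 1, M r ^ 2 * f (Algebra.trace F K r) =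
      ∑ e, (phi F (e + 2) - phi F (e - 2)) * f e := by
  have hF := ringChar_ne_two hq
  let g (e : F) : ℂ := if e + 2 = 0 then 1 else phi F (e + 2)
  have hMg {r : K} (hr : Algebra.norm F r = 1) : M r ^ 2 = g (Algebra.trace F K r) := by
    by_cases htr : Algebra.trace F K r + 2 = 0
    · have hsq := one_add_sq_of_norm_eq_one hr
      rw [htr, map_zero, mul_zero, sq_eq_zero_iff] at hsq
      rw [show g _ = 1 from if_pos htr, eq_neg_of_add_eq_zero_right hsq, ← map_pow,
        neg_one_sq, map_one]
    · rw [show g _ = _ from if_neg htr, apply_sq_eq_phi_trace_add_two hq hM hr htr]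
  have hweight (e : F) :
      (1 - phi F (e ^ 2 - 4 * 1)) * g e = phi F (e + 2) - phi F (e - 2) := by
    by_cases he : e + 2 = 0
    · obtain rfl : e = -2 := eq_neg_of_add_eq_zero_left he
      rw [show g _ = 1 from if_pos he, he, show (-2 : F) - 2 = -2 ^ 2 by norm_num, phi_neg hq,
        phi_sq_eq_one (Ring.two_ne_zero hF)]
      norm_num [MulChar.map_zero]
    · rw [show g _ = _ from if_neg he, show e ^ 2 - 4 * 1 = (e + 2) * (e - 2) by ring, map_mul]
      linear_combination -phi F (e - 2) * phi_mul_self he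
  calc ∑ r : K with Algebra.norm F r = 1, M r ^ 2 * f (Algebra.trace F K r)
    _ = ∑ r : K with Algebra.norm F r = 1, g (Algebra.trace F K r) * f (Algebra.trace F K r) :=
      Finset.sum_congr rfl fun r hr => by rw [hMg (Finset.mem_filter.1 hr).2]
    _ = _ := by
      rw [sum_norm_eq_comp_trace hF 1 fun e => g e * f e]
      simp only [← mul_assoc, hweight]

theorem sum_norm_eq_one_comp_sq (hq : Fintype.card F % 4 = 3) (hM : orderOf M = 8) (h : K → ℂ) :
    ∑ r : K with Algebra.norm F r = 1, h (r ^ 2) =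
      ∑ s : K with Algebra.norm F s = 1, (1 + M s ^ 2) * h s := by
  classical
  have hF := ringChar_ne_two hq
  have hK : ringChar K ≠ 2 := Algebra.ringChar_eq F K ▸ hF
  simp only [Finset.sum_filter]
  -- At `s = r²` the weight `(1 + M(s)²) / 2` is `(1 + φ(N r)) / 2`, which removes the `r` of
  -- norm `-1`.
  calc ∑ r : K, (if Algebra.norm F r = 1 then h (r ^ 2) else 0)
    _ = ∑ r : K, if Algebra.norm F (r ^ 2) = 1 then (1 + M (r ^ 2) ^ 2) / 2 * h (r ^ 2) else 0 := by
      refine Finset.sum_congr rfl fun r _ => ?_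
      have hMr : M (r ^ 2) ^ 2 = phi F (Algebra.norm F r) := by
        rw [map_pow, ← pow_mul, ← apply_pow_four_eq_phi_norm hF hM]
      rw [hMr]
      simp only [map_pow, sq_eq_one_iff]
      split_ifs with h1 h h
      · rw [h1, map_one]
        ring
      · exact absurd (Or.inl h1) h
      · rw [h.resolve_left h1, phi_neg_one hq]
        ring
      · rfl
    _ = ∑ s : K, if Algebra.norm F s = 1 then (1 + M s ^ 2) * h s else 0 := by
      rw [sum_comp_sq hK fun s => if Algebra.norm F s = 1 then (1 + M s ^ 2) / 2 * h s else 0]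
      refine Finset.sum_congr rfl fun s _ => ?_
      split_ifs with hs
      · rw [phi_eq_phi_norm hF, hs, map_one]
        ring
      · rw [mul_zero]

omit [Fintype F] in
theorem sum_norm_eq_one_apply_pow_three_mul [Finite F] (hF : ringChar F ≠ 2) (hM : orderOf M = 8)
    (f : F → ℂ) :
    ∑ s : K with Algebra.norm F s = 1, M s ^ 3 * f (Algebra.trace F K s) =
      ∑ s : K with Algebra.norm F s = 1, M s * f (Algebra.trace F K s) := by
  have := Fintype.ofFinite F
  refine Finset.sum_equiv (conj F K).toEquiv (by simp [norm_conj]) fun s hs => ?_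
  have hs1 : Algebra.norm F s = 1 := (Finset.mem_filter.1 hs).2
  have hM4 : M s ^ 4 = 1 := by rw [apply_pow_four_eq_phi_norm hF hM, hs1, map_one]
  have hconj : M s * M (conj F K s) = 1 := by
    rw [← map_mul, ← algebraMap_norm, hs1, map_one, map_one]
  have hcube : M s ^ 3 = M (conj F K s) := by
    linear_combination M (conj F K s) * hM4 - M s ^ 3 * hconj
  simp only [AlgEquiv.toEquiv_eq_coe, EquivLike.coe_coe, trace_conj, hcube]

theorem sum_norm_eq_one_apply_mul (hq : Fintype.card F % 4 = 3) (hM : orderOf M = 8)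
    (f : F → ℂ) :
    ∑ s : K with Algebra.norm F s = 1, M s * f (Algebra.trace F K s + 2) =
      ∑ e, phi F (e + 2) * f (e ^ 2) := by
  have hsquares :
      ∑ r : K with Algebra.norm F r = 1, M (r ^ 2) * f (Algebra.trace F K (r ^ 2) + 2) =
        2 * ∑ e, phi F (e + 2) * f (e ^ 2) := by
    have hodd : ∑ e, phi F (e - 2) * f (e ^ 2) = -∑ e, phi F (e + 2) * f (e ^ 2) := by
      rw [← Equiv.sum_comp (Equiv.neg F), ← Finset.sum_neg_distrib]
      refine Finset.sum_congr rfl fun e _ => ?_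
      rw [Equiv.neg_apply, ← neg_add', phi_neg hq, neg_sq, neg_mul]
    calc _ = ∑ r : K with Algebra.norm F r = 1, M r ^ 2 * f (Algebra.trace F K r ^ 2) := by
          refine Finset.sum_congr rfl fun r hr => ?_
          rw [map_pow, trace_sq, (Finset.mem_filter.1 hr).2, mul_one, sub_add_cancel]
      _ = _ := by
          rw [sum_norm_eq_one_apply_sq_mul hq hM fun e => f (e ^ 2)]
          simp only [sub_mul, Finset.sum_sub_distrib, hodd]
          ring
  have hfold := sum_norm_eq_one_comp_sq hq hM fun s => M s * f (Algebra.trace F K s + 2)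
  have hcube := sum_norm_eq_one_apply_pow_three_mul (ringChar_ne_two hq) hM fun e => f (e + 2)
  simp only [add_mul, one_mul, ← mul_assoc, ← pow_succ, Finset.sum_add_distrib, hcube] at hfold
  linear_combination (hsquares - hfold) / 2

end OrderEight

section Product

variable {F K : Type*} [Field F] [Fintype F] [DecidableEq F] [Field K] [Fintype K] [Algebra F K]

/-- The Gauss sum of `M` and `z ↦ ψ(c Tr z)` restricted to the fibre `N z = a` of the norm. Up to
the factor `τ⁻¹ φ(j)`, `V p M τ a j` is the case `ψ = psi p F`, `c = j²`. -/
noncomputable def normGaussSum (ψ : AddChar F ℂ) (M : MulChar K ℂ) (a c : F) : ℂ :=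
  ∑ z : K with Algebra.norm F z = a, M z * ψ (c * Algebra.trace F K z)

variable [Algebra.IsQuadraticExtension F K]

theorem normGaussSum_mul_normGaussSum (ψ : AddChar F ℂ) (M : MulChar K ℂ) {a : F} (ha : a ≠ 0)
    (b c : F) :
    normGaussSum ψ M a b * normGaussSum ψ M a c =
      M (algebraMap F K a) * ∑ s : K with Algebra.norm F s = 1, M s *
        ∑ z : K with Algebra.norm F z = a,
          ψ (Algebra.trace F K (z * (algebraMap F K b + algebraMap F K c * conj F K s))) := by
  simp only [Finset.mul_sum]
  rw [Finset.sum_comm, normGaussSum, Finset.sum_mul]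
  refine Finset.sum_congr rfl fun z hz => ?_
  have hz' : Algebra.norm F (conj F K z) = a := (norm_conj z).trans (Finset.mem_filter.1 hz).2
  have hne : conj F K z ≠ 0 := by
    rw [← Algebra.norm_ne_zero_iff (R := F), hz']
    exact ha
  -- The second variable is `w = s * conj z`, so that `z * w = a * s`.
  have hsubst := sum_norm_eq_comp_mul_right (1 : F) hne fun w => M w * ψ (c * Algebra.trace F K w)
  rw [one_mul, hz'] at hsubst
  rw [normGaussSum, ← hsubst, Finset.mul_sum]
  refine Finset.sum_congr rfl fun s _ => ?_
  have hM : M z * M (s * conj F K z) = M (algebraMap F K a) * M s := by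
    rw [← (Finset.mem_filter.1 hz).2, algebraMap_norm, ← map_mul, ← map_mul]
    ring_nf
  have htrace : Algebra.trace F K (z * (algebraMap F K b + algebraMap F K c * conj F K s)) =
      b * Algebra.trace F K z + c * Algebra.trace F K (s * conj F K z) := by
    rw [← trace_conj (s * _), map_mul (conj F K), conj_conj, ← trace_algebraMap_mul,
      ← trace_algebraMap_mul, ← map_add]
    ring_nf
  rw [htrace, AddChar.map_add_eq_mul]
  linear_combination ψ (b * Algebra.trace F K z) * ψ (c * Algebra.trace F K (s * conj F K z)) * hM

omit [DecidableEq F] [Fintype K] in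
theorem norm_add_mul_conj (b c : F) {s : K} (hs : Algebra.norm F s = 1) :
    Algebra.norm F (algebraMap F K b + algebraMap F K c * conj F K s) =
      (b - c) ^ 2 + b * c * (Algebra.trace F K s + 2) := by
  rw [norm_algebraMap_add, norm_algebraMap_mul, trace_algebraMap_mul, norm_conj, trace_conj, hs]
  ring

omit [DecidableEq F] [Fintype K] in
theorem add_mul_conj_eq_zero_iff {b c : F} (hbc : b + c ≠ 0) {s : K} (hs : Algebra.norm F s = 1) :
    algebraMap F K b + algebraMap F K c * conj F K s = 0 ↔ b = c ∧ s = -1 := by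
  constructor
  · intro h
    have hsq : b ^ 2 = c ^ 2 := by
      have hneg : algebraMap F K c * conj F K s = algebraMap F K (-b) := by
        rw [map_neg]
        exact eq_neg_of_add_eq_zero_right h
      have hnorm := congrArg (Algebra.norm F) hneg
      rw [norm_algebraMap_mul, norm_conj, hs, Algebra.norm_algebraMap,
        Algebra.IsQuadraticExtension.finrank_eq_two, neg_sq, mul_one] at hnorm
      exact hnorm.symm
    obtain rfl : b = c :=
      (sq_eq_sq_iff_eq_or_eq_neg.1 hsq).resolve_right fun h => hbc (by rw [h, neg_add_cancel])
    have hb : algebraMap F K b ≠ 0 := by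
      rw [map_ne_zero]
      rintro rfl
      exact hbc (add_zero 0)
    refine ⟨rfl, (conj F K).injective ?_⟩
    rw [map_neg, map_one]
    exact mul_left_cancel₀ hb (by linear_combination h)
  · rintro ⟨rfl, rfl⟩
    rw [map_neg, map_one, mul_neg_one, add_neg_cancel]

theorem normGaussSum_mul_normGaussSum_eq_sub (hF : ringChar F ≠ 2) {ψ : AddChar F ℂ} (hψ : ψ ≠ 1)
    (M : MulChar K ℂ) {a b c : F} (ha : a ≠ 0) (hbc : b + c ≠ 0) :
    normGaussSum ψ M a b * normGaussSum ψ M a c =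
      M (algebraMap F K a) * ((if b = c then (Fintype.card F : ℂ) * M (-1) else 0) -
        ∑ s : K with Algebra.norm F s = 1,
          M s * kloostermanSum ψ (a * ((b - c) ^ 2 + b * c * (Algebra.trace F K s + 2)))) := by
  classical
  have hdiag : ∑ s : K with Algebra.norm F s = 1,
      M s * (if b = c ∧ s = -1 then (Fintype.card F : ℂ) else 0) =
        if b = c then (Fintype.card F : ℂ) * M (-1) else 0 := by
    have hneg : Algebra.norm F (-1 : K) = 1 := by
      simpa using norm_algebraMap_mul (-1 : F) (1 : K)
    split_ifs with h
    · simp [h, hneg, mul_comm]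
    · simp [h]
  rw [normGaussSum_mul_normGaussSum ψ M ha, ← hdiag, ← Finset.sum_sub_distrib]
  congr 1
  refine Finset.sum_congr rfl fun s hs => ?_
  have hs1 : Algebra.norm F s = 1 := (Finset.mem_filter.1 hs).2
  rw [sum_norm_eq_addChar_trace_mul hF hψ ha, norm_add_mul_conj b c hs1, ← mul_sub]
  simp only [add_mul_conj_eq_zero_iff hbc hs1]

end Product

section Main

variable {F : Type*} [Field F] [Fintype F]

theorem sq_add_sq_ne_zero (hq : Fintype.card F % 4 = 3) (j : F) {k : F} (hk : k ≠ 0) :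
    j ^ 2 + k ^ 2 ≠ 0 := by
  intro h
  have hsq : IsSquare (-1 : F) := ⟨j / k, by field_simp; linear_combination -h⟩
  exact FiniteField.isSquare_neg_one_iff.1 hsq hq

variable [DecidableEq F]

theorem delta_add_phi_mul_delta (hq : Fintype.card F % 4 = 3) (j k : F) :
    (if j = k then (1 : ℂ) else 0) + phi F (-1) * (if j = -k then 1 else 0) =
      phi F (j * k) * (if j ^ 2 = k ^ 2 then 1 else 0) := by
  have hF := ringChar_ne_two hq
  rw [phi_neg_one hq]
  rcases eq_or_ne k 0 with rfl | hk
  · rw [neg_zero, mul_zero, MulChar.map_zero]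
    ring
  by_cases hjk : j = k
  · have : j ≠ -j := fun h => hk (hjk ▸ (Ring.eq_self_iff_eq_zero_of_char_ne_two hF).1 h.symm)
    subst hjk
    simp [this, ← sq, phi_sq_eq_one hk]
  by_cases hjk' : j = -k
  · subst hjk'
    simp [hjk, ← sq, phi_neg hq, phi_sq_eq_one hk]
  · simp [hjk, hjk', sq_eq_sq_iff_eq_or_eq_neg]

variable {K : Type*} [Field K] [Fintype K] [Algebra F K] [Algebra.IsQuadraticExtension F K]
  {ψ : AddChar F ℂ} {M : MulChar K ℂ}

theorem sum_norm_eq_one_apply_mul_kloostermanSum (hq : Fintype.card F % 4 = 3)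
    (hψ : ψ.IsPrimitive) (hM : orderOf M = 8) {a j k : F} (ha : a ≠ 0) (hj : j ≠ 0) (hk : k ≠ 0) :
    ∑ s : K with Algebra.norm F s = 1, M s *
        kloostermanSum ψ
          (a * ((j ^ 2 - k ^ 2) ^ 2 + j ^ 2 * k ^ 2 * (Algebra.trace F K s + 2))) =
      phi F 2 * phi F (j * k) *
        (gaussSum (phi F) ψ * mixedSum ψ a ((j + k) ^ 2) ((j - k) ^ 2)) := by
  have hF := ringChar_ne_two hq
  have hjk := mul_ne_zero hj hk
  have hAB : (j + k) ^ 2 + (j - k) ^ 2 ≠ 0 := by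
    rw [show (j + k) ^ 2 + (j - k) ^ 2 = 2 * (j ^ 2 + k ^ 2) by ring]
    exact mul_ne_zero (Ring.two_ne_zero hF) (sq_add_sq_ne_zero hq j hk)
  calc _ = ∑ e, phi F (e + 2) *
        kloostermanSum ψ (a * ((j ^ 2 - k ^ 2) ^ 2 + j ^ 2 * k ^ 2 * e ^ 2)) :=
      sum_norm_eq_one_apply_mul hq hM fun x =>
        kloostermanSum ψ (a * ((j ^ 2 - k ^ 2) ^ 2 + j ^ 2 * k ^ 2 * x))
    _ = phi F (j * k) * ∑ t, phi F (t + 2 * (j * k)) *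
        kloostermanSum ψ (a * ((j ^ 2 - k ^ 2) ^ 2 + t ^ 2)) := by
      rw [← sum_comp_mul_left hjk fun t => phi F (t + 2 * (j * k)) *
        kloostermanSum ψ (a * ((j ^ 2 - k ^ 2) ^ 2 + t ^ 2)), Finset.mul_sum]
      refine Finset.sum_congr rfl fun e _ => ?_
      rw [show j * k * e + 2 * (j * k) = j * k * (e + 2) by ring, map_mul (phi F) (j * k),
        ← mul_assoc, ← mul_assoc, phi_mul_self hjk, one_mul, ← mul_pow, ← mul_pow]
    _ = _ := by
      rw [sum_phi_add_mul_kloostermanSum hF hψ ha, gaussSum_mul_mixedSum hF ψ ha hAB, mul_assoc,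
        mul_left_comm]
      ring_nf

theorem phi_mul_normGaussSum_mul_normGaussSum (hq : Fintype.card F % 4 = 3)
    (hψ : ψ.IsPrimitive) (hM : orderOf M = 8) {a : F} (ha : a ≠ 0) (j k : F) :
    phi F (j * k) * (normGaussSum ψ M a (j ^ 2) * normGaussSum ψ M a (k ^ 2)) =
      phi F 2 * M (algebraMap F K a) *
        (Fintype.card F * (phi F (j * k) * if j ^ 2 = k ^ 2 then 1 else 0) -
          gaussSum (phi F) ψ * mixedSum ψ a ((j + k) ^ 2) ((j - k) ^ 2)) := by
  have hF := ringChar_ne_two hq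
  by_cases hjk : j * k = 0
  · have hsq : (j + k) ^ 2 = (j - k) ^ 2 := by linear_combination 4 * hjk
    simp [hjk, hsq, mixedSum_self_eq_zero hq ψ ha, MulChar.map_zero]
  · have hj := left_ne_zero_of_mul hjk
    have hk := right_ne_zero_of_mul hjk
    have hψ1 : ψ ≠ 1 := by simpa using hψ one_ne_zero
    rw [normGaussSum_mul_normGaussSum_eq_sub hF hψ1 M ha (sq_add_sq_ne_zero hq j hk),
      sum_norm_eq_one_apply_mul_kloostermanSum hq hψ hM ha hj hk, apply_neg_one_eq_phi_two hq hM]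
    split_ifs <;>
      linear_combination (-phi F 2 * M (algebraMap F K a) *
        (gaussSum (phi F) ψ * mixedSum ψ a ((j + k) ^ 2) ((j - k) ^ 2))) * phi_mul_self hjk

end Main

section CanonicalCharacter

variable (p : ℕ) [Fact p.Prime] {F : Type*} [Field F] [Algebra (ZMod p) F]

theorem psi_apply (x : F) : psi p F x = ZMod.stdAddChar (Algebra.trace (ZMod p) F x) := rfl

theorem psi_isPrimitive [Finite F] : (psi p F).IsPrimitive := by
  refine AddChar.IsPrimitive.of_ne_one (AddChar.ne_one_iff.2 ?_)
  obtain ⟨x, hx⟩ := Algebra.trace_surjective (ZMod p) F 1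
  refine ⟨x, fun h => ?_⟩
  rw [psi_apply, hx, ← AddChar.map_zero_eq_one (ZMod.stdAddChar (N := p))] at h
  exact one_ne_zero (ZMod.injective_stdAddChar h)

variable {K : Type*} [Field K] [Algebra (ZMod p) K] [Algebra F K]

theorem psi_eq_psi_trace [Finite F] [Finite K] (z : K) :
    psi p K z = psi p F (Algebra.trace F K z) := by
  have : IsScalarTower (ZMod p) F K :=
    IsScalarTower.of_algebraMap_eq' (Subsingleton.elim _ _)
  rw [psi_apply, psi_apply, Algebra.trace_trace]

theorem V_eq_normGaussSum [Fintype F] [DecidableEq F] [Fintype K] (M : MulChar K ℂ) (τ : ℂ)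
    (a j : F) :
    V p M τ a j = τ⁻¹ * phi F j * normGaussSum (psi p F) M a (j ^ 2) := by
  refine congrArg _ (Finset.sum_congr rfl fun z _ => ?_)
  rw [psi_eq_psi_trace p (F := F), ← map_pow, trace_algebraMap_mul]

end CanonicalCharacter

end KatzSums

open KatzSums in
theorem mainTheorem1_general {F K : Type*} [Field F] [Fintype F] [DecidableEq F]
    [Field K] [Fintype K] [Algebra F K] [Algebra.IsQuadraticExtension F K]
    (hq : Fintype.card F % 4 = 3) {ψ : AddChar F ℂ} (hψ : ψ.IsPrimitive)
    {M : MulChar K ℂ} (hM : orderOf M = 8) {a : F} (ha : a ≠ 0)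
    {τ : ℂ} (hτ : τ ^ 2 = (Fintype.card F : ℂ) * M (algebraMap F K (-a))) (j k : F) :
    (if j = k then 1 else 0) + phi F (-1) * (if j = -k then 1 else 0) +
        1 / gaussSum (phi F) ψ * mixedSum ψ a ((j + k) ^ 2) ((j - k) ^ 2) =
      (τ⁻¹ * phi F j * normGaussSum ψ M a (j ^ 2)) *
        (τ⁻¹ * phi F k * normGaussSum ψ M a (k ^ 2)) := by
  have hG : gaussSum (phi F) ψ ≠ 0 := gaussSum_phi_ne_zero (ringChar_ne_two hq) hψ
  have hMa : M (algebraMap F K (-a)) = phi F 2 * M (algebraMap F K a) := by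
    rw [map_neg, ← neg_one_mul, map_mul, apply_neg_one_eq_phi_two hq hM]
  have hτ0 : τ ≠ 0 := by
    have hunit : IsUnit (algebraMap F K (-a)) := (isUnit_iff_ne_zero.2 (neg_ne_zero.2 ha)).map _
    rw [← pow_ne_zero_iff two_ne_zero, hτ]
    exact mul_ne_zero (Nat.cast_ne_zero.2 Fintype.card_ne_zero) (hunit.map M).ne_zero
  have hτinv : τ⁻¹ ^ 2 * (Fintype.card F * M (algebraMap F K (-a))) = 1 := by
    rw [← hτ, ← mul_pow, inv_mul_cancel₀ hτ0, one_pow]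
  have hcard : (Fintype.card F : ℂ) * (1 / gaussSum (phi F) ψ) = -gaussSum (phi F) ψ := by
    rw [← neg_eq_iff_eq_neg.2 (gaussSum_phi_sq hq hψ)]
    field_simp
  have hprod := phi_mul_normGaussSum_mul_normGaussSum hq hψ hM ha j k
  rw [← hMa, ← delta_add_phi_mul_delta hq, map_mul] at hprod
  set D : ℂ := (if j = k then 1 else 0) + phi F (-1) * (if j = -k then 1 else 0)
  set S := mixedSum ψ a ((j + k) ^ 2) ((j - k) ^ 2)
  linear_combination -τ⁻¹ ^ 2 * hprod - (D + 1 / gaussSum (phi F) ψ * S) * hτinv +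
    τ⁻¹ ^ 2 * M (algebraMap F K (-a)) * S * hcard

theorem mainTheorem1 (p : ℕ) [Fact p.Prime]
    {F K : Type*} [Field F] [Fintype F] [DecidableEq F] [Algebra (ZMod p) F]
    [Field K] [Fintype K] [Algebra (ZMod p) K]
    [Algebra F K] (hK : Module.finrank F K = 2)
    (hq : Fintype.card F % 4 = 3)
    (M₈ : MulChar K ℂ) (hM₈ : orderOf M₈ = 8)
    (a : F) (ha : a ≠ 0)
    (τ : ℂ) (hτ : τ ^ 2 = (Fintype.card F : ℂ) * M₈ (algebraMap F K (-a)))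
    (j k : F) :
    KatzSums.P p a j k = KatzSums.V p M₈ τ a j * KatzSums.V p M₈ τ a k := by
  have : Algebra.IsQuadraticExtension F K := ⟨hK⟩
  rw [KatzSums.V_eq_normGaussSum, KatzSums.V_eq_normGaussSum]
  exact mainTheorem1_general hq (KatzSums.psi_isPrimitive p) hM₈ ha hτ j k
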